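/- Let $(\Omega,\mathcal T,\mathbb P)$ be a probability space, let $Z$ be a random variable on it with values in a measurable space, and let $(X_j)_{j\ge 1}$ be real random variables with $\mathbb E|X_j|^3<\infty$ for all $j$ that are conditionally independent given $Z$, i.e. for every finite set $J$ of indices and all Borel sets $B_j$, $$\mathbb P(X_j\in B_j \text{ for all } j\in J\mid Z)=\prod_{j\in J}\mathbb P(X_j\in B_j\mid Z)\quad\text{a.s.}$$ Put $$\sigma_{j,Z}^2=\operatorname{var}(X_j\mid Z)=\mathbb E\big[(X_j-\mathbb E[X_j\mid Z])^2\mid Z\big],\qquad s_{n,Z}^2=\sum_{j=1}^n\sigma_{j,Z}^2,\qquad \bar X_n=\frac1{s_{n,Z}}\sum_{j=1}^n\big(X_j-\mathbb E[X_j\mid Z]\big).$$ Then for every $n$ such that $s_{n,Z}>0$ almost surely, $\bar X_n$ is integrable and $$d_W(\bar X_n,\mathcal N(0,1))\le 2(\sqrt2+1)\,\mathbb E\left[\frac1{s_{n,Z}^3}\sum_{i=1}^n\big|X_i-\mathbb E[X_i\mid Z]\big|^3\right],$$ where the right-hand side takes values in $[0,\infty]$ and $d_W(\bar X_n,\mathcal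 N(0,1))=\sup_h\left|\mathbb E[h(\bar X_n)]-\int h\,d\mathcal N(0,1)\right|$, the supremum being over all $1$-Lipschitz functions $h:\mathbb R\to\mathbb R$, is the 1-Wasserstein distance between the law of $\bar X_n$ and the standard normal law. -/

import Mathlib

open MeasureTheory ProbabilityTheory
open scoped ENNReal

/-- The random variables `X i` are (mutually) conditionally independent given `Z`: for every finite
set `s` of indices and all measurable sets `B i`,
`P(X i ∈ B i for all i ∈ s | Z) = ∏ i ∈ s, P(X i ∈ B i | Z)` almost surely.
Unlike `ProbabilityTheory.iCondIndepFun`, this does not ask `Ω` to be a standard Borel space; the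
two notions agree when it is one, see `condIndepGiven_iff_iCondIndepFun`. -/
def CondIndepGiven {Ω E ι : Type*} {β : ι → Type*} {mΩ : MeasurableSpace Ω} [mE : MeasurableSpace E]
    [∀ i, MeasurableSpace (β i)] (μ : Measure Ω) (Z : Ω → E) (X : ∀ i, Ω → β i) : Prop :=
  ∀ (s : Finset ι) (B : ∀ i, Set (β i)), (∀ i ∈ s, MeasurableSet (B i)) →
    μ⟦⋂ i ∈ s, X i ⁻¹' B i | mE.comap Z⟧ =ᵐ[μ] ∏ i ∈ s, μ⟦X i ⁻¹' B i | mE.comap Z⟧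

theorem condIndepGiven_iff_iCondIndepFun {Ω E ι : Type*} {β : ι → Type*} {mΩ : MeasurableSpace Ω}
    [StandardBorelSpace Ω] [mE : MeasurableSpace E] [mβ : ∀ i, MeasurableSpace (β i)]
    (μ : Measure Ω) [IsFiniteMeasure μ] (Z : Ω → E) (hZ : Measurable Z) (X : ∀ i, Ω → β i)
    (hX : ∀ i, Measurable (X i)) :
    CondIndepGiven μ Z X ↔ iCondIndepFun (mE.comap Z) hZ.comap_le X μ :=
  ⟨fun h => (iCondIndepFun_iff_condExp_inter_preimage_eq_mul mβ X hX).2 fun S B hB => h S B hB,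
    fun h S B hB => (iCondIndepFun_iff_condExp_inter_preimage_eq_mul mβ X hX).1 h S hB⟩

/-- The 1-Wasserstein distance between two laws on the real line (with finite first moments), as
the supremum of `|∫ h dP - ∫ h dQ|` over all 1-Lipschitz functions `h`. -/
noncomputable def wassersteinOne (P Q : Measure ℝ) : ℝ≥0∞ :=
  ⨆ (h : ℝ → ℝ) (_ : LipschitzWith 1 h), ENNReal.ofReal |∫ x, h x ∂P - ∫ x, h x ∂Q|

/-- `s_{n,Z} = (∑_{j=1}^n Var(X_j | Z))^{1/2}`. -/
noncomputable def condStdDevSum {Ω E : Type*} {mΩ : MeasurableSpace Ω} [mE : MeasurableSpace E]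
    (μ : Measure Ω) (Z : Ω → E) (X : ℕ → Ω → ℝ) (n : ℕ) (ω : Ω) : ℝ :=
  √(∑ j ∈ Finset.Icc 1 n, (Var[X j; μ | mE.comap Z]) ω)

/-- `X_j - E[X_j | Z]`. -/
noncomputable def condCentered {Ω E : Type*} {mΩ : MeasurableSpace Ω} [mE : MeasurableSpace E]
    (μ : Measure Ω) (Z : Ω → E) (X : ℕ → Ω → ℝ) (j : ℕ) (ω : Ω) : ℝ :=
  X j ω - (μ[X j | mE.comap Z]) ω

/-- `X̄_n = s_{n,Z}⁻¹ ∑_{j=1}^n (X_j - E[X_j | Z])`. -/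
noncomputable def condNormalizedSum {Ω E : Type*} {mΩ : MeasurableSpace Ω} [MeasurableSpace E]
    (μ : Measure Ω) (Z : Ω → E) (X : ℕ → Ω → ℝ) (n : ℕ) (ω : Ω) : ℝ :=
  1 / condStdDevSum μ Z X n ω * ∑ j ∈ Finset.Icc 1 n, condCentered μ Z X j ω

/-!
The proof is Stein's method carried out with conditional expectations, so that no regular
conditional distributions are needed and `Ω` may be any probability space.

Write `s` for `s_{n,Z}`. Let `Y i = (X i - E[X i | Z]) / s`, let `T` be the sum of the `Y i`
and `W i = T - Y i`. Let `h` be `1`-Lipschitz and let `f` solve Stein's equation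
`f' x - x f x = h x - ∫ h dN(0, 1)`.

* The Stein factors. If `H` is nondecreasing with Gaussian mean zero, then the solution `f` of
  `f' - x f = H` satisfies `f ≤ 0` and `(x f)' ≤ 0`; the second inequality reduces to Mills'
  bound on the Gaussian tail (`steinSolution_deriv_mul_nonpos`). A `1`-Lipschitz `H` is handled by
  applying this to the nondecreasing functions `x + H` and `x - H`, because the identity has the
  Stein solution `-1`. Hence `|f| ≤ 1`, the function `x f` is `1`-Lipschitz, and `f' = x f + H` is
  `2`-Lipschitz (`LipschitzWith.steinSolution_bounds`). No derivative of `h` is involved.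

* Conditional independence. Let `G i` be the σ-algebra generated by `Z` and the `X j` with `j ≠ i`.
  A π-system argument shows that `E[ψ | G i] = E[ψ | Z]` for every integrable function `ψ` of `Z`
  and `X i` (`CondIndepGiven.condExp_sigmaOthers`). So, given `G i`, the summand `Y i` has mean zero
  and second moment `v i = Var(X i | Z) / s²`, while `W i` is `G i`-measurable and `∑ v i = 1`.

* Stein's identity. `E h(T) - ∫ h dN(0, 1)` is the sum of the terms `E[v i f'(T) - Y i f(T)]`.
  Since `E[Y i f(W i)] = 0` and `E[(Y i² - v i) f'(W i)] = 0`, each of them equals the mean of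
  `v i (f'(T) - f'(W i)) - Y i (f(T) - f(W i) - Y i f'(W i))`, whose absolute value is at most
  `2 v i |Y i| + 2 |Y i|³`. Finally `E[v i |Y i|] ≤ E|Y i|³`
  (`abs_integral_stein_summand_le`), which gives the constant `4 ≤ 2 (√2 + 1)`.

The boundedness of `f` and `f'` makes square integrability of the `Y i` enough for every expectation
above to exist, except for the third moments, which may be assumed finite as the bound is trivial
otherwise. Square integrability holds without any lower bound on `s` because `v i ≤ 1`
(`memLp_condSummand`).
-/

/-! ### The Gaussian weight and its tails -/

/-- The unnormalised standard normal density `t ↦ exp (-t² / 2)`. -/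
noncomputable def gaussWeight (t : ℝ) : ℝ := Real.exp (-(t ^ 2 / 2))

theorem gaussWeight_pos (t : ℝ) : 0 < gaussWeight t := Real.exp_pos _

theorem exp_mul_gaussWeight (t : ℝ) : Real.exp (t ^ 2 / 2) * gaussWeight t = 1 := by
  rw [gaussWeight, ← Real.exp_add, add_neg_cancel, Real.exp_zero]

theorem continuous_gaussWeight : Continuous gaussWeight := by
  unfold gaussWeight; fun_prop

theorem hasDerivAt_gaussWeight (t : ℝ) : HasDerivAt gaussWeight (-t * gaussWeight t) t := by
  have h : HasDerivAt (fun t : ℝ => -(t ^ 2 / 2)) (-t) t :=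
    ((hasDerivAt_pow 2 t).div_const 2).neg.congr_deriv (by norm_num)
  exact h.exp.congr_deriv (mul_comm _ _)

theorem integrable_gaussWeight : Integrable gaussWeight := by
  have h := integrable_exp_neg_mul_sq (b := 1 / 2) (by norm_num)
  convert h using 2 with t
  unfold gaussWeight; congr 1; ring

theorem integrable_mul_gaussWeight : Integrable fun t : ℝ => t * gaussWeight t := by
  have h := integrable_mul_exp_neg_mul_sq (b := 1 / 2) (by norm_num)
  convert h using 3 with t
  unfold gaussWeight; congr 1; ring

theorem tendsto_gaussWeight_of_sq {l : Filter ℝ}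
    (hl : Filter.Tendsto (fun t : ℝ => t ^ 2) l Filter.atTop) :
    Filter.Tendsto gaussWeight l (nhds 0) :=
  Real.tendsto_exp_atBot.comp
    (Filter.tendsto_neg_atTop_atBot.comp (hl.atTop_div_const (by norm_num)))

theorem tendsto_gaussWeight_atTop : Filter.Tendsto gaussWeight Filter.atTop (nhds 0) :=
  tendsto_gaussWeight_of_sq (Filter.tendsto_pow_atTop (by norm_num))

theorem tendsto_gaussWeight_atBot : Filter.Tendsto gaussWeight Filter.atBot (nhds 0) := by
  refine tendsto_gaussWeight_of_sq ?_
  simpa [Function.comp_def] using!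
    (Filter.tendsto_pow_atTop (α := ℝ) (n := 2) (by norm_num)).comp Filter.tendsto_neg_atBot_atTop

theorem integral_Iic_mul_gaussWeight (x : ℝ) :
    ∫ t in Set.Iic x, t * gaussWeight t = -gaussWeight x := by
  have h := integral_Iic_of_hasDerivAt_of_tendsto' (a := x) (f := fun t => -gaussWeight t)
    (f' := fun t => t * gaussWeight t) (m := 0)
    (fun t _ => (hasDerivAt_gaussWeight t).neg.congr_deriv (by ring))
    integrable_mul_gaussWeight.integrableOn (by simpa using tendsto_gaussWeight_atBot.neg)
  simpa using h

/-- Mills' lower bound for the Gaussian tail. It holds because `-t / (1 + t²) * exp (-t² / 2)` has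
derivative `(1 - 2 / (1 + t²)²) * exp (-t² / 2)`. -/
theorem mul_gaussWeight_le_integral_Ioi (x : ℝ) :
    x / (1 + x ^ 2) * gaussWeight x ≤ ∫ t in Set.Ioi x, gaussWeight t := by
  have hpos : ∀ t : ℝ, 0 < 1 + t ^ 2 := fun t => by positivity
  have hint : Integrable fun t : ℝ => (1 - 2 / (1 + t ^ 2) ^ 2) * gaussWeight t := by
    refine integrable_gaussWeight.bdd_mul (c := 3) ?_ (Filter.Eventually.of_forall fun t => ?_)
    · exact Continuous.aestronglyMeasurable (by
        refine continuous_const.sub (continuous_const.div (by fun_prop) fun t => ?_)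
        exact (pow_pos (hpos t) 2).ne')
    · have h1 : 2 / (1 + t ^ 2) ^ 2 ≤ 2 := by
        rw [div_le_iff₀ (pow_pos (hpos t) 2)]
        nlinarith [sq_nonneg t, sq_nonneg (t ^ 2)]
      have h2 : 0 ≤ 2 / (1 + t ^ 2) ^ 2 := by positivity
      rw [Real.norm_eq_abs, abs_le]
      constructor <;> linarith
  have hder : ∀ t : ℝ, HasDerivAt (fun t : ℝ => -(t / (1 + t ^ 2) * gaussWeight t))
      ((1 - 2 / (1 + t ^ 2) ^ 2) * gaussWeight t) t := by
    intro t
    have h1 : HasDerivAt (fun t : ℝ => 1 + t ^ 2) (2 * t) t := by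
      simpa using (hasDerivAt_pow 2 t).const_add 1
    refine (((hasDerivAt_id t).div h1 (hpos t).ne').mul
      (hasDerivAt_gaussWeight t)).neg.congr_deriv ?_
    have := (hpos t).ne'
    simp only [id, Pi.div_apply]
    field_simp
    ring
  have hlim : Filter.Tendsto (fun t : ℝ => -(t / (1 + t ^ 2) * gaussWeight t))
      Filter.atTop (nhds 0) := by
    refine squeeze_zero_norm (fun t => ?_) tendsto_gaussWeight_atTop
    rw [norm_neg, norm_mul, Real.norm_of_nonneg (gaussWeight_pos t).le]
    refine mul_le_of_le_one_left (gaussWeight_pos t).le ?_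
    rw [norm_div, Real.norm_of_nonneg (hpos t).le, div_le_one (hpos t), Real.norm_eq_abs,
      abs_le]
    constructor <;> nlinarith [sq_nonneg (t - 1), sq_nonneg (t + 1)]
  have h := integral_Ioi_of_hasDerivAt_of_tendsto' (a := x) (fun t _ => hder t) hint.integrableOn
    hlim
  rw [zero_sub, neg_neg] at h
  rw [← h]
  refine setIntegral_mono hint.integrableOn integrable_gaussWeight.integrableOn fun t => ?_
  refine mul_le_of_le_one_left (gaussWeight_pos t).le ?_
  have : 0 ≤ 2 / (1 + t ^ 2) ^ 2 := by positivity
  linarith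

theorem neg_mul_gaussWeight_le_integral_Iic (x : ℝ) :
    -x / (1 + x ^ 2) * gaussWeight x ≤ ∫ t in Set.Iic x, gaussWeight t := by
  have h := mul_gaussWeight_le_integral_Ioi (-x)
  rw [← integral_comp_neg_Iic] at h
  simpa [gaussWeight] using h

/-! ### Stein's equation -/

/-- The solution `x ↦ exp (x² / 2) ∫_{-∞}^x H(t) exp (-t² / 2) dt` of Stein's equation
`f' x - x f x = H x`. -/
noncomputable def steinSolution (H : ℝ → ℝ) (x : ℝ) : ℝ :=
  Real.exp (x ^ 2 / 2) * ∫ t in Set.Iic x, H t * gaussWeight t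

theorem hasDerivAt_steinSolution {H : ℝ → ℝ} (hc : Continuous H)
    (hi : Integrable fun t => H t * gaussWeight t) (x : ℝ) :
    HasDerivAt (steinSolution H) (x * steinSolution H x + H x) x := by
  have hcw : Continuous fun t => H t * gaussWeight t := hc.mul continuous_gaussWeight
  have h1 : HasDerivAt (fun y => ∫ t in Set.Iic y, H t * gaussWeight t)
      (H x * gaussWeight x) x := by
    have h2 : HasDerivAt (fun y => (∫ t in (0 : ℝ)..y, H t * gaussWeight t) +
        ∫ t in Set.Iic (0 : ℝ), H t * gaussWeight t) (H x * gaussWeight x) x :=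
      (intervalIntegral.integral_hasDerivAt_right (hcw.intervalIntegrable _ _)
        (hcw.stronglyMeasurableAtFilter _ _) hcw.continuousAt).add_const _
    refine h2.congr_of_eventuallyEq (Filter.Eventually.of_forall fun y => ?_)
    have := intervalIntegral.integral_Iic_sub_Iic (hi.integrableOn (s := Set.Iic (0 : ℝ)))
      (hi.integrableOn (s := Set.Iic y))
    simp only
    linarith
  have h3 : HasDerivAt (fun y : ℝ => Real.exp (y ^ 2 / 2)) (Real.exp (x ^ 2 / 2) * x) x := by
    have : HasDerivAt (fun t : ℝ => t ^ 2 / 2) x x :=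
      ((hasDerivAt_pow 2 x).div_const 2).congr_deriv (by norm_num)
    exact this.exp
  refine (h3.mul h1).congr_deriv ?_
  have := exp_mul_gaussWeight x
  unfold steinSolution
  linear_combination (H x) * this

theorem steinSolution_id (x : ℝ) : steinSolution (fun t => t) x = -1 := by
  rw [steinSolution, integral_Iic_mul_gaussWeight]
  linarith [exp_mul_gaussWeight x]

section Monotone

variable {H : ℝ → ℝ}

theorem steinSolution_eq_neg_integral_Ioi (hi : Integrable fun t => H t * gaussWeight t)
    (h0 : ∫ t, H t * gaussWeight t = 0) (x : ℝ) :
    steinSolution H x = -(Real.exp (x ^ 2 / 2) * ∫ t in Set.Ioi x, H t * gaussWeight t) := by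
  have h := intervalIntegral.integral_Iic_add_Ioi (b := x) hi.integrableOn hi.integrableOn
  rw [h0] at h
  rw [steinSolution, eq_neg_of_add_eq_zero_left h]
  ring

theorem steinSolution_le_mul_integral_Iic (hm : Monotone H)
    (hi : Integrable fun t => H t * gaussWeight t) (x : ℝ) :
    steinSolution H x ≤ H x * (Real.exp (x ^ 2 / 2) * ∫ t in Set.Iic x, gaussWeight t) := by
  rw [steinSolution, mul_left_comm, ← integral_const_mul (H x)]
  refine mul_le_mul_of_nonneg_left ?_ (Real.exp_pos _).le
  exact setIntegral_mono_on hi.integrableOn (integrable_gaussWeight.const_mul _).integrableOn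
    measurableSet_Iic fun t ht => mul_le_mul_of_nonneg_right (hm ht) (gaussWeight_pos t).le

theorem steinSolution_le_neg_mul_integral_Ioi (hm : Monotone H)
    (hi : Integrable fun t => H t * gaussWeight t) (h0 : ∫ t, H t * gaussWeight t = 0) (x : ℝ) :
    steinSolution H x ≤ -(H x * (Real.exp (x ^ 2 / 2) * ∫ t in Set.Ioi x, gaussWeight t)) := by
  rw [steinSolution_eq_neg_integral_Ioi hi h0, mul_left_comm, ← integral_const_mul (H x)]
  refine neg_le_neg (mul_le_mul_of_nonneg_left ?_ (Real.exp_pos _).le)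
  exact setIntegral_mono_on (integrable_gaussWeight.const_mul _).integrableOn hi.integrableOn
    measurableSet_Ioi fun t ht =>
      mul_le_mul_of_nonneg_right (hm (le_of_lt ht)) (gaussWeight_pos t).le

theorem steinSolution_nonpos (hm : Monotone H) (hi : Integrable fun t => H t * gaussWeight t)
    (h0 : ∫ t, H t * gaussWeight t = 0) (x : ℝ) : steinSolution H x ≤ 0 := by
  have hw : ∀ s : Set ℝ, 0 ≤ Real.exp (x ^ 2 / 2) * ∫ t in s, gaussWeight t := fun s =>
    mul_nonneg (Real.exp_pos _).le (integral_nonneg fun t => (gaussWeight_pos t).le)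
  rcases le_total (H x) 0 with hx | hx
  · exact (steinSolution_le_mul_integral_Iic hm hi x).trans
      (mul_nonpos_of_nonpos_of_nonneg hx (hw _))
  · exact (steinSolution_le_neg_mul_integral_Ioi hm hi h0 x).trans
      (neg_nonpos.2 (mul_nonneg hx (hw _)))

/-- The left-hand side is the derivative of `x ↦ x * steinSolution H x`. -/
theorem steinSolution_deriv_mul_nonpos (hm : Monotone H)
    (hi : Integrable fun t => H t * gaussWeight t) (h0 : ∫ t, H t * gaussWeight t = 0) (x : ℝ) :
    (1 + x ^ 2) * steinSolution H x + x * H x ≤ 0 := by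
  have hpos : 0 < 1 + x ^ 2 := by positivity
  have hS := steinSolution_nonpos hm hi h0 x
  have hE := Real.exp_pos (x ^ 2 / 2)
  have hE1 := exp_mul_gaussWeight x
  by_cases hsign : x * H x ≤ 0
  · nlinarith
  -- Otherwise `x` and `H x` have the same sign and Mills' bound applies to the tail beyond `x`.
  rcases le_total 0 x with hx | hx
  · have hH : 0 ≤ H x := by
      by_contra! h
      exact hsign (mul_nonpos_of_nonneg_of_nonpos hx h.le)
    have h1 : x / (1 + x ^ 2) ≤ Real.exp (x ^ 2 / 2) * ∫ t in Set.Ioi x, gaussWeight t := by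
      have := mul_le_mul_of_nonneg_left (mul_gaussWeight_le_integral_Ioi x) hE.le
      rwa [mul_left_comm, hE1, mul_one] at this
    rw [div_le_iff₀ hpos] at h1
    have h2 := steinSolution_le_neg_mul_integral_Ioi hm hi h0 x
    nlinarith
  · have hH : H x ≤ 0 := by
      by_contra! h
      exact hsign (mul_nonpos_of_nonpos_of_nonneg hx h.le)
    have h1 : -x / (1 + x ^ 2) ≤ Real.exp (x ^ 2 / 2) * ∫ t in Set.Iic x, gaussWeight t := by
      have := mul_le_mul_of_nonneg_left (neg_mul_gaussWeight_le_integral_Iic x) hE.le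
      rwa [mul_left_comm, hE1, mul_one] at this
    rw [div_le_iff₀ hpos] at h1
    have h2 := steinSolution_le_mul_integral_Iic hm hi x
    nlinarith

end Monotone

section Lipschitz

variable {H : ℝ → ℝ}

theorem LipschitzWith.integrable_mul_gaussWeight (hH : LipschitzWith 1 H) :
    Integrable fun t => H t * gaussWeight t := by
  refine Integrable.mono' ((integrable_gaussWeight.const_mul |H 0|).add
    _root_.integrable_mul_gaussWeight.norm)
    (hH.continuous.mul continuous_gaussWeight).aestronglyMeasurable
    (Filter.Eventually.of_forall fun t => ?_)
  have h1 : |H t - H 0| ≤ |t| := by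
    have := hH.dist_le_mul t 0
    simpa [Real.dist_eq] using this
  have h2 : |H t| ≤ |H 0| + |t| := by
    have := abs_sub_abs_le_abs_sub (H t) (H 0)
    linarith
  simp only [Pi.add_apply, norm_mul, Real.norm_eq_abs, abs_of_pos (gaussWeight_pos t)]
  nlinarith [gaussWeight_pos t]

/-- Both `t + H t` and `t - H t` are nondecreasing, and the identity has the constant Stein solution
`-1`, so a sign on monotone functions becomes a two-sided bound on `1`-Lipschitz ones. -/
theorem LipschitzWith.steinSolution_add_smul_bounds (hH : LipschitzWith 1 H)
    (h0 : ∫ t, H t * gaussWeight t = 0) {ε : ℝ} (hε : |ε| = 1) (x : ℝ) :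
    ε * steinSolution H x ≤ 1 ∧
      ε * ((1 + x ^ 2) * steinSolution H x + x * H x) ≤ 1 := by
  have hi := hH.integrable_mul_gaussWeight
  have hG : (fun t => (t + ε * H t) * gaussWeight t) =
      fun t => t * gaussWeight t + ε * (H t * gaussWeight t) := by ext t; ring
  have hGi : Integrable fun t => (t + ε * H t) * gaussWeight t := by
    rw [hG]; exact _root_.integrable_mul_gaussWeight.add (hi.const_mul _)
  have hid0 : ∫ t, t * gaussWeight t = 0 := by
    have h := integral_neg_eq_self (fun t : ℝ => t * gaussWeight t) volume
    simp only [gaussWeight, neg_mul, even_two, Even.neg_pow, integral_neg] at h ⊢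
    linarith
  have hG0 : ∫ t, (t + ε * H t) * gaussWeight t = 0 := by
    rw [hG, integral_add _root_.integrable_mul_gaussWeight (hi.const_mul _), integral_const_mul,
      h0, hid0]
    simp
  have hGm : Monotone fun t => t + ε * H t := by
    intro s t hst
    have h1 : |H t - H s| ≤ t - s := by
      have := hH.dist_le_mul t s
      rwa [Real.dist_eq, Real.dist_eq, abs_of_nonneg (sub_nonneg.2 hst), NNReal.coe_one,
        one_mul] at this
    have h2 : |ε * (H t - H s)| ≤ t - s := by rwa [abs_mul, hε, one_mul]
    have := (abs_le.1 h2).1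
    simp only
    linarith
  have hGS : steinSolution (fun t => t + ε * H t) x = -1 + ε * steinSolution H x := by
    rw [← steinSolution_id x]
    simp only [steinSolution]
    rw [hG, integral_add _root_.integrable_mul_gaussWeight.integrableOn
      (hi.const_mul _).integrableOn, integral_const_mul]
    ring
  have hA := steinSolution_nonpos hGm hGi hG0 x
  have hB := steinSolution_deriv_mul_nonpos hGm hGi hG0 x
  rw [hGS] at hA hB
  constructor <;> linarith

/-- Stein's factors for a `1`-Lipschitz function `H` of Gaussian mean zero: the solution is bounded
by `1`, and its derivative `x * f x + H x` is `2`-Lipschitz. -/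
theorem LipschitzWith.steinSolution_bounds (hH : LipschitzWith 1 H)
    (h0 : ∫ t, H t * gaussWeight t = 0) :
    (∀ x, |steinSolution H x| ≤ 1) ∧
      LipschitzWith 2 fun x => x * steinSolution H x + H x := by
  have hpos := hH.steinSolution_add_smul_bounds h0 (ε := 1) (by simp)
  have hneg := hH.steinSolution_add_smul_bounds h0 (ε := -1) (by simp)
  refine ⟨fun x => abs_le.2 ⟨by linarith [(hneg x).1], by linarith [(hpos x).1]⟩, ?_⟩
  have hder : ∀ x, HasDerivAt (fun x => x * steinSolution H x)
      ((1 + x ^ 2) * steinSolution H x + x * H x) x := fun x => by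
    refine ((hasDerivAt_id x).mul
      (hasDerivAt_steinSolution hH.continuous hH.integrable_mul_gaussWeight x)).congr_deriv ?_
    simp only [id]
    ring
  have hL : LipschitzWith 1 fun x => x * steinSolution H x := by
    refine lipschitzWith_of_nnnorm_deriv_le (fun x => (hder x).differentiableAt) fun x => ?_
    rw [← NNReal.coe_le_coe, coe_nnnorm, (hder x).deriv, Real.norm_eq_abs, NNReal.coe_one]
    exact abs_le.2 ⟨by linarith [(hneg x).2], by linarith [(hpos x).2]⟩
  have := hL.add hH
  rwa [one_add_one_eq_two] at this

end Lipschitz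

/-- For a `1`-Lipschitz function `h`, Stein's equation `f' x - x f x = h x - ∫ h dN(0, 1)` has a
solution `f` with `|f| ≤ 1` whose derivative is bounded and `2`-Lipschitz. -/
theorem exists_stein_solution {h : ℝ → ℝ} (hh : LipschitzWith 1 h) :
    ∃ f f' : ℝ → ℝ, (∀ x, HasDerivAt f (f' x) x) ∧ (∀ x, |f x| ≤ 1) ∧ (∀ x, |f' x| ≤ 4) ∧
      LipschitzWith 2 f' ∧ ∀ x, f' x - x * f x = h x - ∫ y, h y ∂gaussianReal 0 1 := by
  set N := ∫ y, h y ∂gaussianReal 0 1 with hN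
  have hH : LipschitzWith 1 fun x => h x - N := by
    simpa using! hh.sub (LipschitzWith.const N)
  have hpdf : ∀ t, gaussianPDFReal 0 1 t = (√(2 * Real.pi))⁻¹ * gaussWeight t := fun t => by
    simp [gaussianPDFReal, gaussWeight, neg_div]
  have hNint : N = (√(2 * Real.pi))⁻¹ * ∫ t, h t * gaussWeight t := by
    rw [hN, integral_gaussianReal_eq_integral_smul one_ne_zero, ← integral_const_mul]
    congr 1 with t
    rw [hpdf, smul_eq_mul]; ring
  have hone : 1 = (√(2 * Real.pi))⁻¹ * ∫ t, gaussWeight t := by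
    rw [← integral_const_mul, ← integral_gaussianPDFReal_eq_one 0 one_ne_zero]
    simp only [hpdf]
  have h0 : ∫ t, (h t - N) * gaussWeight t = 0 := by
    simp only [sub_mul]
    rw [integral_sub hh.integrable_mul_gaussWeight (integrable_gaussWeight.const_mul _),
      integral_const_mul]
    have hpi : (√(2 * Real.pi))⁻¹ ≠ 0 := inv_ne_zero (by positivity)
    refine mul_left_cancel₀ hpi ?_
    linear_combination N * hone - hNint
  obtain ⟨hb, hL⟩ := hH.steinSolution_bounds h0
  set f := steinSolution fun x => h x - N
  have hd : ∀ x, HasDerivAt f (x * f x + (h x - N)) x :=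
    hasDerivAt_steinSolution hH.continuous hH.integrable_mul_gaussWeight
  refine ⟨f, _, hd, hb, fun x => ?_, hL, fun x => by ring⟩
  -- `f' x` is within `2` of a slope of `f` over an interval of length one.
  obtain ⟨ξ, hξ, hslope⟩ := exists_hasDerivAt_eq_slope f _ (lt_add_one x)
    (fun y _ => (hd y).continuousAt.continuousWithinAt) (fun y _ => hd y)
  have h1 := hL.dist_le_mul ξ x
  rw [Real.dist_eq, Real.dist_eq, hslope, abs_of_pos (sub_pos.2 hξ.1), add_sub_cancel_left,
    div_one] at h1
  have h2 := abs_le.1 h1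
  have h3 := abs_le.1 (hb x)
  have h4 := abs_le.1 (hb (x + 1))
  have h5 := hξ.2
  norm_num at h2
  exact abs_le.2 ⟨by linarith, by linarith⟩

/-! ### Conditional independence and conditional expectations -/

section CondIndep

variable {Ω : Type*} {m mΩ : MeasurableSpace Ω} {μ : Measure Ω} [IsFiniteMeasure μ]

/-- Adding `generateFrom π` to the conditioning does not change `μ[f | m]` as soon as the defining
identity of conditional expectations holds on the sets `A ∩ C` with `A` in `m` and `C` in `π`. -/
theorem condExp_sup_generateFrom_of_setIntegral_eq (hm : m ≤ mΩ) {π : Set (Set Ω)}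
    (hπ : IsPiSystem π) (hπm : ∀ C ∈ π, MeasurableSet C) (hu : Set.univ ∈ π) {f : Ω → ℝ}
    (hf : Integrable f μ)
    (h : ∀ A C, MeasurableSet[m] A → C ∈ π →
      ∫ ω in A ∩ C, (μ[f | m]) ω ∂μ = ∫ ω in A ∩ C, f ω ∂μ) :
    μ[f | m ⊔ MeasurableSpace.generateFrom π] =ᵐ[μ] μ[f | m] := by
  have hle : m ⊔ MeasurableSpace.generateFrom π ≤ mΩ :=
    sup_le hm (MeasurableSpace.generateFrom_le hπm)
  set 𝒟 : Set (Set Ω) := Set.image2 (· ∩ ·) {A | MeasurableSet[m] A} π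
  have hgen : m ⊔ MeasurableSpace.generateFrom π = MeasurableSpace.generateFrom 𝒟 := by
    apply le_antisymm
    · refine sup_le (fun A hA => ?_) (MeasurableSpace.generateFrom_le fun C hC => ?_)
      · exact MeasurableSpace.measurableSet_generateFrom ⟨A, hA, Set.univ, hu, by simp⟩
      · exact MeasurableSpace.measurableSet_generateFrom
          ⟨Set.univ, MeasurableSet.univ, C, hC, by simp⟩
    · refine MeasurableSpace.generateFrom_le ?_
      rintro _ ⟨A, hA, C, hC, rfl⟩
      exact MeasurableSet.inter ((le_sup_left : m ≤ _) A hA)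
        ((le_sup_right : _ ≤ m ⊔ MeasurableSpace.generateFrom π) C
          (MeasurableSpace.measurableSet_generateFrom hC))
  have hpi : IsPiSystem 𝒟 := by
    rintro _ ⟨A, hA, C, hC, rfl⟩ _ ⟨A', hA', C', hC', rfl⟩ hne
    simp only [Set.inter_inter_inter_comm A C A' C'] at hne ⊢
    exact ⟨A ∩ A', MeasurableSet.inter hA hA', C ∩ C', hπ C hC C' hC' hne.right, rfl⟩
  have hg : Integrable (μ[f | m]) μ := integrable_condExp
  have hgm : StronglyMeasurable[m ⊔ MeasurableSpace.generateFrom π] (μ[f | m]) :=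
    stronglyMeasurable_condExp.mono le_sup_left
  refine (ae_eq_condExp_of_forall_setIntegral_eq hle hf (fun s _ _ => hg.integrableOn)
    (fun s hs _ => ?_)
    hgm.aestronglyMeasurable).symm
  induction s, hs using MeasurableSpace.induction_on_inter hgen hpi with
  | empty => simp
  | basic D hD =>
    obtain ⟨A, hA, C, hC, rfl⟩ := hD
    exact h A C hA hC
  | compl D hD ih =>
    have h1 := integral_add_compl (hle D hD) hf
    have h2 := integral_add_compl (hle D hD) hg
    have h3 : ∫ ω, (μ[f | m]) ω ∂μ = ∫ ω, f ω ∂μ := integral_condExp hm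
    have ih := ih (measure_lt_top _ _)
    linarith
  | iUnion D hdisj hD ih =>
    rw [integral_iUnion (fun n => hle _ (hD n)) hdisj hf.integrableOn,
      integral_iUnion (fun n => hle _ (hD n)) hdisj hg.integrableOn]
    exact tsum_congr fun n => ih n (measure_lt_top _ _)

/-- If the π-systems `π₁` and `π₂` are conditionally independent given `m`, then further
conditioning on `π₂` does not change the conditional expectation given `m` of a function measurable
with respect to `m` and `π₁`. -/
theorem condExp_sup_generateFrom_of_condIndep (hm : m ≤ mΩ) {π₁ π₂ : Set (Set Ω)}
    (hπ₁ : IsPiSystem π₁) (hπ₂ : IsPiSystem π₂)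
    (hπm₁ : ∀ B ∈ π₁, MeasurableSet B) (hπm₂ : ∀ C ∈ π₂, MeasurableSet C)
    (hu₁ : Set.univ ∈ π₁) (hu₂ : Set.univ ∈ π₂)
    (h : ∀ B ∈ π₁, ∀ C ∈ π₂, μ⟦B ∩ C | m⟧ =ᵐ[μ] μ⟦B | m⟧ * μ⟦C | m⟧)
    {ψ : Ω → ℝ} (hψ : Integrable ψ μ)
    (hψm : StronglyMeasurable[m ⊔ MeasurableSpace.generateFrom π₁] ψ) :
    μ[ψ | m ⊔ MeasurableSpace.generateFrom π₂] =ᵐ[μ] μ[ψ | m] := by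
  have hle₁ : m ⊔ MeasurableSpace.generateFrom π₁ ≤ mΩ :=
    sup_le hm (MeasurableSpace.generateFrom_le hπm₁)
  have hone : ∀ {C : Set Ω}, MeasurableSet C → Integrable (C.indicator fun _ => (1 : ℝ)) μ :=
    fun hC => (integrable_const 1).indicator hC
  have hmul : ∀ (C : Set Ω) (u : Ω → ℝ), C.indicator (fun _ => (1 : ℝ)) * u = C.indicator u := by
    intro C u
    ext ω
    by_cases hω : ω ∈ C <;> simp [hω]
  -- Indicators of sets in `π₂` first, by testing against the sets of `m` and `π₁`.
  have key : ∀ C ∈ π₂, μ⟦C | m ⊔ MeasurableSpace.generateFrom π₁⟧ =ᵐ[μ] μ⟦C | m⟧ := by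
    intro C hC
    refine condExp_sup_generateFrom_of_setIntegral_eq hm hπ₁ hπm₁ hu₁ (hone (hπm₂ C hC)) ?_
    intro A B hA hB
    have hBm := hπm₁ B hB
    have hCm := hπm₂ C hC
    have hint : Integrable (B.indicator (fun _ => (1 : ℝ)) * μ⟦C | m⟧) μ := by
      rw [hmul]; exact integrable_condExp.indicator hBm
    have hpull := condExp_mul_of_stronglyMeasurable_right
      (stronglyMeasurable_condExp (μ := μ) (m := m) (f := C.indicator fun _ => (1 : ℝ)))
      hint (hone hBm)
    calc ∫ ω in A ∩ B, (μ⟦C | m⟧) ω ∂μ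
        = ∫ ω in A, (B.indicator (fun _ => (1 : ℝ)) * μ⟦C | m⟧) ω ∂μ := by
          rw [hmul, setIntegral_indicator hBm]
      _ = ∫ ω in A, (μ[B.indicator (fun _ => (1 : ℝ)) * μ⟦C | m⟧ | m]) ω ∂μ :=
          (setIntegral_condExp hm hint hA).symm
      _ = ∫ ω in A, (μ⟦B ∩ C | m⟧) ω ∂μ :=
          setIntegral_congr_ae (hm A hA)
            ((hpull.trans (h B hB C hC).symm).mono fun ω hω _ => hω)
      _ = ∫ ω in A, (B ∩ C).indicator (fun _ => (1 : ℝ)) ω ∂μ :=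
          setIntegral_condExp hm (hone (hBm.inter hCm)) hA
      _ = ∫ ω in A ∩ B, C.indicator (fun _ => (1 : ℝ)) ω ∂μ := by
          rw [← Set.indicator_indicator, setIntegral_indicator hBm]
  refine condExp_sup_generateFrom_of_setIntegral_eq hm hπ₂ hπm₂ hu₂ hψ ?_
  intro A C hA hC
  have hCm := hπm₂ C hC
  have hint₁ : Integrable (C.indicator (fun _ => (1 : ℝ)) * ψ) μ := by
    rw [hmul]; exact hψ.indicator hCm
  have hint₂ : Integrable (C.indicator (fun _ => (1 : ℝ)) * μ[ψ | m]) μ := by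
    rw [hmul]; exact integrable_condExp.indicator hCm
  have e₁ : μ[C.indicator (fun _ => (1 : ℝ)) * ψ | m ⊔ MeasurableSpace.generateFrom π₁]
      =ᵐ[μ] μ⟦C | m⟧ * ψ :=
    (condExp_mul_of_stronglyMeasurable_right hψm hint₁ (hone hCm)).trans
      ((key C hC).mul Filter.EventuallyEq.rfl)
  have hint₃ : Integrable (μ⟦C | m⟧ * ψ) μ := integrable_condExp.congr e₁
  have e₂ : μ[μ⟦C | m⟧ * ψ | m] =ᵐ[μ] μ⟦C | m⟧ * μ[ψ | m] :=
    condExp_mul_of_stronglyMeasurable_left stronglyMeasurable_condExp hint₃ hψ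
  have e₃ : μ[C.indicator (fun _ => (1 : ℝ)) * μ[ψ | m] | m] =ᵐ[μ] μ⟦C | m⟧ * μ[ψ | m] :=
    condExp_mul_of_stronglyMeasurable_right stronglyMeasurable_condExp hint₂ (hone hCm)
  calc ∫ ω in A ∩ C, (μ[ψ | m]) ω ∂μ
      = ∫ ω in A, (C.indicator (fun _ => (1 : ℝ)) * μ[ψ | m]) ω ∂μ := by
        rw [hmul, setIntegral_indicator hCm]
    _ = ∫ ω in A, (μ[C.indicator (fun _ => (1 : ℝ)) * μ[ψ | m] | m]) ω ∂μ :=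
        (setIntegral_condExp hm hint₂ hA).symm
    _ = ∫ ω in A, (μ[μ⟦C | m⟧ * ψ | m]) ω ∂μ :=
        setIntegral_congr_ae (hm A hA) ((e₃.trans e₂.symm).mono fun ω hω _ => hω)
    _ = ∫ ω in A, (μ⟦C | m⟧ * ψ) ω ∂μ := setIntegral_condExp hm hint₃ hA
    _ = ∫ ω in A, (μ[C.indicator (fun _ => (1 : ℝ)) * ψ |
          m ⊔ MeasurableSpace.generateFrom π₁]) ω ∂μ :=
        setIntegral_congr_ae (hm A hA) (e₁.symm.mono fun ω hω _ => hω)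
    _ = ∫ ω in A, (C.indicator (fun _ => (1 : ℝ)) * ψ) ω ∂μ :=
        setIntegral_condExp hle₁ hint₁ ((le_sup_left : m ≤ _) A hA)
    _ = ∫ ω in A ∩ C, ψ ω ∂μ := by
        rw [hmul, setIntegral_indicator hCm]

end CondIndep

/-- The σ-algebra generated by `Z` and all the `X j` with `j ≠ i`. -/
abbrev sigmaOthers {Ω E ι : Type*} {β : ι → Type*} [mE : MeasurableSpace E]
    [mβ : ∀ i, MeasurableSpace (β i)] (Z : Ω → E) (X : ∀ i, Ω → β i) (i : ι) : MeasurableSpace Ω :=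
  mE.comap Z ⊔ ⨆ j ∈ ({i}ᶜ : Set ι), (mβ j).comap (X j)

section CondIndepGiven

variable {Ω E ι : Type*} {β : ι → Type*} {mΩ : MeasurableSpace Ω} [mE : MeasurableSpace E]
  [mβ : ∀ i, MeasurableSpace (β i)] {μ : Measure Ω} {Z : Ω → E} {X : ∀ i, Ω → β i}

theorem sigmaOthers_le (hZ : Measurable Z) (hX : ∀ i, Measurable (X i)) (i : ι) :
    sigmaOthers Z X i ≤ mΩ :=
  sup_le hZ.comap_le (iSup₂_le fun j _ => (hX j).comap_le)

theorem sup_comap_le_sigmaOthers {i j : ι} (hij : j ≠ i) :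
    mE.comap Z ⊔ (mβ j).comap (X j) ≤ sigmaOthers Z X i :=
  sup_le_sup_left (le_iSup₂_of_le (f := fun j (_ : j ∈ ({i}ᶜ : Set ι)) => (mβ j).comap (X j))
    j hij le_rfl) _

/-- Under conditional independence given `Z`, conditioning a function of `Z` and `X i` on `Z` and
the other variables is the same as conditioning it on `Z`. -/
theorem CondIndepGiven.condExp_sigmaOthers [IsFiniteMeasure μ] (h : CondIndepGiven μ Z X)
    (hZ : Measurable Z) (hX : ∀ i, Measurable (X i)) (i : ι) {ψ : Ω → ℝ} (hψ : Integrable ψ μ)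
    (hψm : StronglyMeasurable[mE.comap Z ⊔ (mβ i).comap (X i)] ψ) :
    μ[ψ | sigmaOthers Z X i] =ᵐ[μ] μ[ψ | mE.comap Z] := by
  classical
  set π₁ : Set (Set Ω) := {s | MeasurableSet[(mβ i).comap (X i)] s}
  set π₂ : Set (Set Ω) :=
    piiUnionInter (fun j => {s | MeasurableSet[(mβ j).comap (X j)] s}) {i}ᶜ
  have hgen₁ : MeasurableSpace.generateFrom π₁ = (mβ i).comap (X i) :=
    @MeasurableSpace.generateFrom_measurableSet Ω ((mβ i).comap (X i))
  have hgen₂ : MeasurableSpace.generateFrom π₂ = ⨆ j ∈ ({i}ᶜ : Set ι), (mβ j).comap (X j) :=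
    generateFrom_piiUnionInter_measurableSet (fun j => (mβ j).comap (X j)) _
  have hmem₂ : ∀ C ∈ π₂, MeasurableSet C := fun C hC => by
    have : MeasurableSet[MeasurableSpace.generateFrom π₂] C :=
      MeasurableSpace.measurableSet_generateFrom hC
    rw [hgen₂] at this
    exact (iSup₂_le fun j _ => (hX j).comap_le : _ ≤ mΩ) C this
  have main := condExp_sup_generateFrom_of_condIndep (μ := μ) hZ.comap_le
    (π₁ := π₁) (π₂ := π₂)
    (@MeasurableSpace.isPiSystem_measurableSet Ω ((mβ i).comap (X i)))
    (isPiSystem_piiUnionInter _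
      (fun j => @MeasurableSpace.isPiSystem_measurableSet Ω ((mβ j).comap (X j))) _)
    (fun B hB => (hX i).comap_le B hB) hmem₂
    (@MeasurableSet.univ Ω ((mβ i).comap (X i))) ⟨∅, by simp, fun _ => ∅, by simp, by simp⟩
    ?_ hψ (by rwa [hgen₁])
  · rwa [hgen₂] at main
  rintro _ ⟨B, hB, rfl⟩ _ ⟨t, ht, f, hf, rfl⟩
  have hit : i ∉ t := fun hi => ht hi rfl
  have hf' : ∀ j, ∃ C : Set (β j), j ∈ t → MeasurableSet C ∧ X j ⁻¹' C = f j := fun j => by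
    by_cases hj : j ∈ t
    · obtain ⟨C, hC, hCf⟩ := hf j hj
      exact ⟨C, fun _ => ⟨hC, hCf⟩⟩
    · exact ⟨∅, fun h => absurd h hj⟩
  choose C hC using hf'
  have hBi : ∀ j ∈ insert i t, MeasurableSet (Function.update C i B j) := by
    intro j hj
    rcases eq_or_ne j i with rfl | hne
    · simpa using hB
    · rw [Function.update_of_ne hne]
      exact (hC j ((Finset.mem_insert.1 hj).resolve_left hne)).1
  have h₁ := h (insert i t) (Function.update C i B) hBi
  have h₂ := h t C fun j hj => (hC j hj).1
  have hset : ⋂ j ∈ t, X j ⁻¹' C j = ⋂ j ∈ t, f j :=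
    Set.iInter₂_congr fun j hj => (hC j hj).2
  have hset' : ∀ j ∈ t, X j ⁻¹' Function.update C i B j = X j ⁻¹' C j := fun j hj => by
    rw [Function.update_of_ne (ne_of_mem_of_not_mem hj hit)]
  rw [Finset.set_biInter_insert, Function.update_self, Set.iInter₂_congr hset', hset,
    Finset.prod_insert hit, Function.update_self,
    Finset.prod_congr rfl fun j hj => by rw [hset' j hj]] at h₁
  rw [hset] at h₂
  exact h₁.trans (Filter.EventuallyEq.rfl.mul h₂.symm)

end CondIndepGiven

/-! ### Stein's method for sums of conditionally centred variables -/

section Stein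

variable {Ω : Type*} {G mΩ : MeasurableSpace Ω} {μ : Measure Ω} [IsProbabilityMeasure μ]

theorem integral_mul_eq_zero_of_condExp_eq_zero {m : MeasurableSpace Ω} (hm : m ≤ mΩ)
    {g u : Ω → ℝ} (hg : StronglyMeasurable[m] g) {c : ℝ} (hc : ∀ᵐ ω ∂μ, |g ω| ≤ c)
    (hu : Integrable u μ) (h0 : μ[u | m] =ᵐ[μ] 0) : ∫ ω, g ω * u ω ∂μ = 0 := by
  have h := condExp_stronglyMeasurable_mul_of_bound hm hg hu c hc
  have h1 : ∫ ω, (μ[g * u | m]) ω ∂μ = ∫ ω, g ω * u ω ∂μ := integral_condExp hm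
  rw [← h1, integral_congr_ae h, ← integral_zero Ω ℝ]
  exact integral_congr_ae (h0.mono fun ω hω => by simp [hω])

/-- First-order Taylor bound for a function with `2`-Lipschitz derivative. -/
theorem abs_taylor_le {f f' : ℝ → ℝ} (hf : ∀ x, HasDerivAt f (f' x) x) (hL : LipschitzWith 2 f')
    (x y : ℝ) : |f (x + y) - f x - y * f' x| ≤ 2 * y ^ 2 := by
  have hg : ∀ z, HasDerivAt (fun z => f z - z * f' x) (f' z - f' x) z := fun z =>
    ((hf z).sub ((hasDerivAt_id z).mul_const (f' x))).congr_deriv (by simp)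
  have hb : ∀ z ∈ Set.uIcc x (x + y), ‖f' z - f' x‖ ≤ 2 * |y| := fun z hz => by
    have h1 := hL.dist_le_mul z x
    have h2 : |z - x| ≤ |x + y - x| := Set.abs_sub_left_of_mem_uIcc hz
    rw [add_sub_cancel_left] at h2
    rw [Real.dist_eq, Real.dist_eq, NNReal.coe_ofNat] at h1
    rw [Real.norm_eq_abs]
    linarith
  have h := (convex_uIcc x (x + y)).norm_image_sub_le_of_norm_hasDerivWithin_le
    (fun z _ => (hg z).hasDerivWithinAt) hb Set.left_mem_uIcc Set.right_mem_uIcc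
  rw [add_sub_cancel_left, Real.norm_eq_abs, Real.norm_eq_abs] at h
  calc |f (x + y) - f x - y * f' x| = |f (x + y) - (x + y) * f' x - (f x - x * f' x)| := by
        congr 1; ring
    _ ≤ 2 * |y| * |y| := h
    _ = 2 * y ^ 2 := by rw [mul_assoc, ← sq, sq_abs]

variable {Y W v : Ω → ℝ}

/-- The contribution of a single summand `Y` to Stein's identity, when `Y` has conditional mean zero
and conditional variance `v` given a σ-algebra `G` for which the rest `W` of the sum is
measurable. -/
theorem abs_integral_stein_summand_le (hG : G ≤ mΩ) {f f' : ℝ → ℝ}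
    (hf : ∀ x, HasDerivAt f (f' x) x) (hfb : ∀ x, |f x| ≤ 1) (hfb' : ∀ x, |f' x| ≤ 4)
    (hL : LipschitzWith 2 f') (hY : MemLp Y 2 μ) (hY3 : Integrable (fun ω => |Y ω| ^ 3) μ)
    (hW : StronglyMeasurable[G] W) (hv : StronglyMeasurable[G] v)
    (hv01 : ∀ᵐ ω ∂μ, 0 ≤ v ω ∧ v ω ≤ 1) (hmean : μ[Y | G] =ᵐ[μ] 0)
    (hvar : μ[fun ω => Y ω ^ 2 | G] =ᵐ[μ] v) :
    |∫ ω, (v ω * f' (W ω + Y ω) - Y ω * f (W ω + Y ω)) ∂μ| ≤ 4 * ∫ ω, |Y ω| ^ 3 ∂μ := by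
  have hYi : Integrable Y μ := hY.integrable one_le_two
  have hY2 : Integrable (fun ω => Y ω ^ 2) μ := hY.integrable_sq
  have hfc : Continuous f := continuous_iff_continuousAt.2 fun x => (hf x).continuousAt
  have hfc' : Continuous f' := hL.continuous
  have hWm : StronglyMeasurable W := hW.mono hG
  have hvm : StronglyMeasurable v := hv.mono hG
  have hvi : Integrable v μ := integrable_condExp.congr hvar
  have hu : Integrable (fun ω => Y ω ^ 2 - v ω) μ := hY2.sub hvi
  have hu0 : μ[fun ω => Y ω ^ 2 - v ω | G] =ᵐ[μ] 0 := by
    have h1 : μ[fun ω => Y ω ^ 2 - v ω | G] =ᵐ[μ] μ[fun ω => Y ω ^ 2 | G] - μ[v | G] :=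
      condExp_sub hY2 hvi G
    rw [condExp_of_stronglyMeasurable hG hv hvi] at h1
    filter_upwards [h1, hvar] with ω h1 h2
    rw [h1, Pi.sub_apply, h2, sub_self, Pi.zero_apply]
  have hWY : AEStronglyMeasurable (fun ω => W ω + Y ω) μ :=
    hWm.aestronglyMeasurable.add hY.aestronglyMeasurable
  -- Three vanishing terms: `Y f(W)`, `(Y² - v) f'(W)` and `(Y² - v) √v`.
  have z₁ : ∫ ω, f (W ω) * Y ω ∂μ = 0 :=
    integral_mul_eq_zero_of_condExp_eq_zero hG (hfc.comp_stronglyMeasurable hW) (c := 1)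
      (Filter.Eventually.of_forall fun ω => hfb _) hYi hmean
  have z₂ : ∫ ω, f' (W ω) * (Y ω ^ 2 - v ω) ∂μ = 0 :=
    integral_mul_eq_zero_of_condExp_eq_zero hG (hfc'.comp_stronglyMeasurable hW) (c := 4)
      (Filter.Eventually.of_forall fun ω => hfb' _) hu hu0
  have z₃ : ∫ ω, √(v ω) * (Y ω ^ 2 - v ω) ∂μ = 0 := by
    refine integral_mul_eq_zero_of_condExp_eq_zero hG
      (Real.continuous_sqrt.comp_stronglyMeasurable hv) (c := 1) ?_ hu hu0
    filter_upwards [hv01] with ω hω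
    rw [abs_of_nonneg (Real.sqrt_nonneg _)]
    exact Real.sqrt_le_one.2 hω.2
  have i₁ : Integrable (fun ω => f (W ω) * Y ω) μ :=
    hYi.bdd_mul (c := 1) (hfc.comp_aestronglyMeasurable hWm.aestronglyMeasurable)
      (Filter.Eventually.of_forall fun ω => hfb _)
  have i₂ : Integrable (fun ω => f' (W ω) * (Y ω ^ 2 - v ω)) μ :=
    hu.bdd_mul (c := 4) (hfc'.comp_aestronglyMeasurable hWm.aestronglyMeasurable)
      (Filter.Eventually.of_forall fun ω => hfb' _)
  have i₃ : Integrable (fun ω => √(v ω) * (Y ω ^ 2 - v ω)) μ := by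
    refine hu.bdd_mul (c := 1)
      (Real.continuous_sqrt.comp_aestronglyMeasurable hvm.aestronglyMeasurable) ?_
    filter_upwards [hv01] with ω hω
    rw [Real.norm_eq_abs, abs_of_nonneg (Real.sqrt_nonneg _)]
    exact Real.sqrt_le_one.2 hω.2
  have i₄ : Integrable (fun ω => f (W ω + Y ω) * Y ω) μ :=
    hYi.bdd_mul (c := 1) (hfc.comp_aestronglyMeasurable hWY)
      (Filter.Eventually.of_forall fun ω => hfb _)
  have i₅ : Integrable (fun ω => f' (W ω + Y ω) * v ω) μ :=
    hvi.bdd_mul (c := 4) (hfc'.comp_aestronglyMeasurable hWY)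
      (Filter.Eventually.of_forall fun ω => hfb' _)
  have hrw : ∫ ω, (v ω * f' (W ω + Y ω) - Y ω * f (W ω + Y ω)) ∂μ =
      ∫ ω, (f' (W ω + Y ω) * v ω - f (W ω + Y ω) * Y ω + f (W ω) * Y ω +
        f' (W ω) * (Y ω ^ 2 - v ω)) ∂μ := by
    have i₆ : Integrable (fun ω => f' (W ω + Y ω) * v ω - f (W ω + Y ω) * Y ω) μ := i₅.sub i₄
    have i₇ : Integrable (fun ω => f' (W ω + Y ω) * v ω - f (W ω + Y ω) * Y ω + f (W ω) * Y ω) μ :=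
      i₆.add i₁
    rw [integral_add i₇ i₂, integral_add i₆ i₁, z₁, z₂, add_zero, add_zero]
    congr 1 with ω
    ring
  have hbound : ∫ ω, (4 * |Y ω| ^ 3 - 2 * (√(v ω) * (Y ω ^ 2 - v ω))) ∂μ =
      4 * ∫ ω, |Y ω| ^ 3 ∂μ := by
    rw [integral_sub (hY3.const_mul _) (i₃.const_mul _), integral_const_mul, integral_const_mul,
      z₃, mul_zero, sub_zero]
  rw [hrw, ← hbound, ← Real.norm_eq_abs]
  refine norm_integral_le_of_norm_le ((hY3.const_mul _).sub (i₃.const_mul _)) ?_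
  filter_upwards [hv01] with ω hω
  have h1 := abs_taylor_le hf hL (W ω) (Y ω)
  have h2 : |f' (W ω + Y ω) - f' (W ω)| ≤ 2 * |Y ω| := by
    simpa [Real.dist_eq] using hL.dist_le_mul (W ω + Y ω) (W ω)
  have hr := Real.sqrt_nonneg (v ω)
  have hr2 := Real.sq_sqrt hω.1
  have hy := abs_nonneg (Y ω)
  have hy2 := sq_abs (Y ω)
  -- `v |Y| ≤ |Y|³ - √v (Y² - v)`, since the difference is `(|Y| - √v)² (|Y| + √v)`.
  have h3 : v ω * |Y ω| ≤ |Y ω| ^ 3 - √(v ω) * (Y ω ^ 2 - v ω) := by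
    have : 0 ≤ (|Y ω| - √(v ω)) ^ 2 * (|Y ω| + √(v ω)) := by positivity
    linear_combination this + (√(v ω) - |Y ω|) * hr2 - √(v ω) * hy2
  calc ‖f' (W ω + Y ω) * v ω - f (W ω + Y ω) * Y ω + f (W ω) * Y ω +
        f' (W ω) * (Y ω ^ 2 - v ω)‖
      = |v ω * (f' (W ω + Y ω) - f' (W ω)) -
          Y ω * (f (W ω + Y ω) - f (W ω) - Y ω * f' (W ω))| := by
        rw [Real.norm_eq_abs]; congr 1; ring
    _ ≤ v ω * |f' (W ω + Y ω) - f' (W ω)| +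
          |Y ω| * |f (W ω + Y ω) - f (W ω) - Y ω * f' (W ω)| := by
        refine (abs_sub _ _).trans_eq ?_
        rw [abs_mul, abs_mul, abs_of_nonneg hω.1]
    _ ≤ v ω * (2 * |Y ω|) + |Y ω| * (2 * Y ω ^ 2) := by
        gcongr
        exact hω.1
    _ ≤ 4 * |Y ω| ^ 3 - 2 * (√(v ω) * (Y ω ^ 2 - v ω)) := by
        linear_combination 2 * h3 - 2 * |Y ω| * hy2

/-- Stein's bound for a sum of variables `Y i`, each with conditional mean zero and conditional
variance `v i` given a σ-algebra that makes the sum of the others measurable. -/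
theorem abs_integral_lipschitz_sub_gaussian_le {ι : Type*} (S : Finset ι)
    {G : ι → MeasurableSpace Ω} (hG : ∀ i, G i ≤ mΩ) {Y v : ι → Ω → ℝ}
    (hY : ∀ i ∈ S, MemLp (Y i) 2 μ) (hY3 : ∀ i ∈ S, Integrable (fun ω => |Y i ω| ^ 3) μ)
    (hW : ∀ i ∈ S, StronglyMeasurable[G i] fun ω => (∑ j ∈ S, Y j ω) - Y i ω)
    (hv : ∀ i ∈ S, StronglyMeasurable[G i] (v i))
    (hv0 : ∀ᵐ ω ∂μ, ∀ i ∈ S, 0 ≤ v i ω) (hv1 : ∀ᵐ ω ∂μ, ∑ i ∈ S, v i ω = 1)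
    (hmean : ∀ i ∈ S, μ[Y i | G i] =ᵐ[μ] 0)
    (hvar : ∀ i ∈ S, μ[fun ω => Y i ω ^ 2 | G i] =ᵐ[μ] v i)
    {h : ℝ → ℝ} (hh : LipschitzWith 1 h) :
    |∫ ω, h (∑ i ∈ S, Y i ω) ∂μ - ∫ x, h x ∂gaussianReal 0 1| ≤
      4 * ∑ i ∈ S, ∫ ω, |Y i ω| ^ 3 ∂μ := by
  obtain ⟨f, f', hf, hfb, hfb', hL, heq⟩ := exists_stein_solution hh
  have hfc : Continuous f := continuous_iff_continuousAt.2 fun x => (hf x).continuousAt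
  have hfc' : Continuous f' := hL.continuous
  set T : Ω → ℝ := fun ω => ∑ i ∈ S, Y i ω
  set N := ∫ x, h x ∂gaussianReal 0 1
  have hTm : AEStronglyMeasurable T μ :=
    Finset.aestronglyMeasurable_fun_sum S fun i hi => (hY i hi).aestronglyMeasurable
  have hsummand : ∀ i ∈ S, Integrable (fun ω => v i ω * f' (T ω) - Y i ω * f (T ω)) μ := by
    intro i hi
    refine Integrable.sub ?_ ?_
    · exact (integrable_condExp.congr (hvar i hi)).mul_bdd (c := 4)
        (hfc'.comp_aestronglyMeasurable hTm) (Filter.Eventually.of_forall fun ω => hfb' _)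
    · exact ((hY i hi).integrable one_le_two).mul_bdd (c := 1)
        (hfc.comp_aestronglyMeasurable hTm) (Filter.Eventually.of_forall fun ω => hfb _)
  have hdecomp : (fun ω => h (T ω) - N) =ᵐ[μ]
      fun ω => ∑ i ∈ S, (v i ω * f' (T ω) - Y i ω * f (T ω)) := by
    filter_upwards [hv1] with ω hω
    rw [Finset.sum_sub_distrib, ← Finset.sum_mul, ← Finset.sum_mul, hω, one_mul, ← heq]
  have hint : Integrable (fun ω => h (T ω) - N) μ :=
    (integrable_finsetSum S hsummand).congr hdecomp.symm
  have hhT : Integrable (fun ω => h (T ω)) μ := by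
    exact (hint.add (integrable_const N)).congr
      (Filter.Eventually.of_forall fun ω => sub_add_cancel _ _)
  have hN : ∫ ω, h (T ω) ∂μ - N = ∑ i ∈ S, ∫ ω, (v i ω * f' (T ω) - Y i ω * f (T ω)) ∂μ := by
    rw [← integral_finsetSum S hsummand, ← integral_congr_ae hdecomp,
      integral_sub hhT (integrable_const N)]
    simp
  rw [hN, Finset.mul_sum]
  refine (Finset.abs_sum_le_sum_abs _ _).trans (Finset.sum_le_sum fun i hi => ?_)
  have hv01 : ∀ᵐ ω ∂μ, 0 ≤ v i ω ∧ v i ω ≤ 1 := by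
    filter_upwards [hv0, hv1] with ω h0 h1
    exact ⟨h0 i hi, h1 ▸ Finset.single_le_sum h0 hi⟩
  simpa only [sub_add_cancel] using abs_integral_stein_summand_le (hG i) hf hfb hfb' hL (hY i hi)
    (hY3 i hi) (hW i hi) (hv i hi) hv01 (hmean i hi) (hvar i hi)

end Stein

/-! ### Normalisation by the conditional standard deviation -/

/-- Pull-out for conditional expectations, with no integrability assumption on the factor `g`. -/
theorem lintegral_mul_ofReal_condExp {Ω : Type*} {m mΩ : MeasurableSpace Ω} {μ : Measure Ω}
    [IsFiniteMeasure μ] (hm : m ≤ mΩ) {g : Ω → ℝ≥0∞} (hg : Measurable[m] g) {ψ : Ω → ℝ}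
    (hψ : Integrable ψ μ) (h0 : 0 ≤ᵐ[μ] ψ) :
    ∫⁻ ω, ENNReal.ofReal (ψ ω) * g ω ∂μ = ∫⁻ ω, ENNReal.ofReal ((μ[ψ | m]) ω) * g ω ∂μ := by
  have hc : Integrable (μ[ψ | m]) μ := integrable_condExp
  have hc0 : 0 ≤ᵐ[μ] μ[ψ | m] := condExp_nonneg h0
  have htrim : (μ.withDensity fun ω => ENNReal.ofReal (ψ ω)).trim hm =
      (μ.withDensity fun ω => ENNReal.ofReal ((μ[ψ | m]) ω)).trim hm := by
    refine @Measure.ext _ m _ _ fun A hA => ?_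
    rw [trim_measurableSet_eq hm hA, trim_measurableSet_eq hm hA, withDensity_apply _ (hm A hA),
      withDensity_apply _ (hm A hA),
      ← ofReal_integral_eq_lintegral_ofReal hψ.integrableOn (ae_restrict_of_ae h0),
      ← ofReal_integral_eq_lintegral_ofReal hc.integrableOn (ae_restrict_of_ae hc0),
      setIntegral_condExp hm hψ hA]
  have hgm : AEMeasurable g μ := (hg.mono hm le_rfl).aemeasurable
  have e₁ := lintegral_withDensity_eq_lintegral_mul₀ hψ.aemeasurable.ennreal_ofReal hgm
  have e₂ := lintegral_withDensity_eq_lintegral_mul₀ hc.aemeasurable.ennreal_ofReal hgm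
  rw [← lintegral_trim hm hg, htrim, lintegral_trim hm hg, e₂] at e₁
  exact e₁.symm

section Normalized

variable {Ω E : Type*} {mΩ : MeasurableSpace Ω} [mE : MeasurableSpace E] {μ : Measure Ω}
  {Z : Ω → E} {X : ℕ → Ω → ℝ}

/-- The `i`-th summand `(X_i - E[X_i | Z]) / s_{n,Z}` of `condNormalizedSum`. -/
noncomputable def condSummand (μ : Measure Ω) (Z : Ω → E) (X : ℕ → Ω → ℝ) (n i : ℕ) (ω : Ω) : ℝ :=
  1 / condStdDevSum μ Z X n ω * condCentered μ Z X i ω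

/-- The conditional variance of `condSummand` given `Z`. -/
noncomputable def condSummandVar (μ : Measure Ω) (Z : Ω → E) (X : ℕ → Ω → ℝ) (n i : ℕ) (ω : Ω) :
    ℝ :=
  (1 / condStdDevSum μ Z X n ω) ^ 2 * (Var[X i; μ | mE.comap Z]) ω

theorem condNormalizedSum_eq_sum (n : ℕ) :
    condNormalizedSum μ Z X n = fun ω => ∑ i ∈ Finset.Icc 1 n, condSummand μ Z X n i ω := by
  ext ω
  simp only [condNormalizedSum, condSummand, Finset.mul_sum]

theorem sum_abs_condSummand_pow_three (n : ℕ) (ω : Ω) :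
    1 / condStdDevSum μ Z X n ω ^ 3 * ∑ i ∈ Finset.Icc 1 n, |condCentered μ Z X i ω| ^ 3 =
      ∑ i ∈ Finset.Icc 1 n, |condSummand μ Z X n i ω| ^ 3 := by
  have hs : 0 ≤ condStdDevSum μ Z X n ω := Real.sqrt_nonneg _
  simp only [condSummand, abs_mul, abs_of_nonneg (one_div_nonneg.2 hs), mul_pow, ← Finset.mul_sum,
    one_div_pow]

theorem stronglyMeasurable_one_div_condStdDevSum (n : ℕ) :
    StronglyMeasurable[mE.comap Z] fun ω => 1 / condStdDevSum μ Z X n ω := by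
  refine Measurable.stronglyMeasurable ?_
  have h : Measurable[mE.comap Z] (condStdDevSum μ Z X n) :=
    Real.continuous_sqrt.measurable.comp (Finset.measurable_fun_sum _ fun j _ =>
      stronglyMeasurable_condVar.measurable)
  exact Measurable.div measurable_const h

theorem stronglyMeasurable_condSummandVar (n i : ℕ) :
    StronglyMeasurable[mE.comap Z] (condSummandVar μ Z X n i) :=
  ((stronglyMeasurable_one_div_condStdDevSum n).pow 2).mul stronglyMeasurable_condVar

theorem stronglyMeasurable_condSummand (n i : ℕ) :
    StronglyMeasurable[mE.comap Z ⊔ Real.measurableSpace.comap (X i)]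
      (condSummand μ Z X n i) := by
  have hX : StronglyMeasurable[mE.comap Z ⊔ Real.measurableSpace.comap (X i)] (X i) :=
    ((comap_measurable (X i)).mono
      (le_sup_right : _ ≤ mE.comap Z ⊔ Real.measurableSpace.comap (X i)) le_rfl).stronglyMeasurable
  have hs := (stronglyMeasurable_one_div_condStdDevSum (μ := μ) (Z := Z) (X := X) n).mono
    (le_sup_left : _ ≤ mE.comap Z ⊔ Real.measurableSpace.comap (X i))
  have he := (stronglyMeasurable_condExp (μ := μ) (m := mE.comap Z) (f := X i)).mono
    (le_sup_left : _ ≤ mE.comap Z ⊔ Real.measurableSpace.comap (X i))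
  exact hs.mul (hX.sub he)

theorem condVar_nonneg (i : ℕ) : 0 ≤ᵐ[μ] Var[X i; μ | mE.comap Z] :=
  condExp_nonneg (Filter.Eventually.of_forall fun _ => sq_nonneg _)

theorem condSummandVar_nonneg (n : ℕ) : ∀ᵐ ω ∂μ, ∀ i, 0 ≤ condSummandVar μ Z X n i ω := by
  refine ae_all_iff.2 fun i => ?_
  filter_upwards [condVar_nonneg (μ := μ) (Z := Z) (X := X) i] with ω h
  exact mul_nonneg (sq_nonneg _) h

theorem sum_condSummandVar {n : ℕ} (hs : ∀ᵐ ω ∂μ, 0 < condStdDevSum μ Z X n ω) :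
    ∀ᵐ ω ∂μ, ∑ i ∈ Finset.Icc 1 n, condSummandVar μ Z X n i ω = 1 := by
  filter_upwards [hs] with ω h
  have h2 : condStdDevSum μ Z X n ω ^ 2 =
      ∑ i ∈ Finset.Icc 1 n, (Var[X i; μ | mE.comap Z]) ω :=
    Real.sq_sqrt (Real.sqrt_pos.1 h).le
  simp only [condSummandVar]
  rw [← Finset.mul_sum, ← h2, ← mul_pow, one_div_mul_cancel h.ne', one_pow]

theorem memLp_condCentered (hX : ∀ j, MemLp (X j) 2 μ) (i : ℕ) :
    MemLp (condCentered μ Z X i) 2 μ :=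
  (hX i).sub ((hX i).condExp (m := mE.comap Z) one_le_two)

theorem condExp_condSummand_sq (hX : ∀ j, MemLp (X j) 2 μ) {n i : ℕ}
    (hY : MemLp (condSummand μ Z X n i) 2 μ) :
    μ[fun ω => condSummand μ Z X n i ω ^ 2 | mE.comap Z] =ᵐ[μ] condSummandVar μ Z X n i := by
  have heq : (fun ω => condSummand μ Z X n i ω ^ 2) =
      (fun ω => (1 / condStdDevSum μ Z X n ω) ^ 2) * fun ω => condCentered μ Z X i ω ^ 2 := by
    ext ω
    simp only [condSummand, mul_pow, Pi.mul_apply]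
  have hint := hY.integrable_sq
  rw [heq] at hint ⊢
  exact condExp_mul_of_stronglyMeasurable_left
    ((stronglyMeasurable_one_div_condStdDevSum n).pow 2) hint
    (memLp_condCentered hX i).integrable_sq

variable [IsProbabilityMeasure μ]

theorem condExp_condCentered (hZ : Measurable Z) (hX : ∀ j, MemLp (X j) 2 μ) (i : ℕ) :
    μ[condCentered μ Z X i | mE.comap Z] =ᵐ[μ] 0 := by
  have h := condExp_sub ((hX i).integrable one_le_two)
    (integrable_condExp (f := X i) (m := mE.comap Z) (μ := μ)) (mE.comap Z)
  rw [condExp_of_stronglyMeasurable hZ.comap_le stronglyMeasurable_condExp integrable_condExp,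
    sub_self] at h
  exact h

/-- The summands have a finite second moment however small `s_{n,Z}` gets, since their conditional
variances given `Z` are at most `1`. -/
theorem memLp_condSummand (hZ : Measurable Z) (hX : ∀ j, MemLp (X j) 2 μ) {n i : ℕ}
    (hi : i ∈ Finset.Icc 1 n) (hs : ∀ᵐ ω ∂μ, 0 < condStdDevSum μ Z X n ω) :
    MemLp (condSummand μ Z X n i) 2 μ := by
  have hsm : AEStronglyMeasurable (condSummand μ Z X n i) μ :=
    ((stronglyMeasurable_one_div_condStdDevSum n).mono hZ.comap_le).aestronglyMeasurable.mul
      (memLp_condCentered hX i).aestronglyMeasurable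
  refine (memLp_two_iff_integrable_sq hsm).2 ⟨hsm.pow 2, ?_⟩
  rw [hasFiniteIntegral_iff_ofReal (Filter.Eventually.of_forall fun ω => sq_nonneg _)]
  have hpull := lintegral_mul_ofReal_condExp hZ.comap_le
    (g := fun ω => ENNReal.ofReal ((1 / condStdDevSum μ Z X n ω) ^ 2))
    ((stronglyMeasurable_one_div_condStdDevSum n).pow 2).measurable.ennreal_ofReal
    (memLp_condCentered (Z := Z) hX i).integrable_sq
    (Filter.Eventually.of_forall fun ω => sq_nonneg _)
  calc ∫⁻ ω, ENNReal.ofReal (condSummand μ Z X n i ω ^ 2) ∂μ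
      = ∫⁻ ω, ENNReal.ofReal (condCentered μ Z X i ω ^ 2) *
          ENNReal.ofReal ((1 / condStdDevSum μ Z X n ω) ^ 2) ∂μ := by
        congr 1 with ω
        rw [← ENNReal.ofReal_mul (sq_nonneg _), condSummand, mul_pow, mul_comm]
    _ = ∫⁻ ω, ENNReal.ofReal ((Var[X i; μ | mE.comap Z]) ω) *
          ENNReal.ofReal ((1 / condStdDevSum μ Z X n ω) ^ 2) ∂μ := hpull
    _ ≤ ∫⁻ _, 1 ∂μ := by
        refine lintegral_mono_ae ?_
        filter_upwards [condSummandVar_nonneg (μ := μ) (Z := Z) (X := X) n, sum_condSummandVar hs]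
          with ω h0 h1
        rw [mul_comm, ← ENNReal.ofReal_mul (sq_nonneg _), ENNReal.ofReal_le_one]
        exact (Finset.single_le_sum (f := fun j => condSummandVar μ Z X n j ω)
          (fun j _ => h0 j) hi).trans_eq h1
    _ < ∞ := by simp

theorem condExp_condSummand (hZ : Measurable Z) (hX : ∀ j, MemLp (X j) 2 μ) {n i : ℕ}
    (hY : MemLp (condSummand μ Z X n i) 2 μ) :
    μ[condSummand μ Z X n i | mE.comap Z] =ᵐ[μ] 0 := by
  have h : μ[condSummand μ Z X n i | mE.comap Z] =ᵐ[μ] _ :=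
    condExp_mul_of_stronglyMeasurable_left (stronglyMeasurable_one_div_condStdDevSum n)
      (hY.integrable one_le_two) ((memLp_condCentered hX i).integrable one_le_two)
  filter_upwards [h, condExp_condCentered hZ hX i] with ω h1 h2
  rw [h1, Pi.mul_apply, h2, Pi.zero_apply, mul_zero]

end Normalized

theorem mainTheorem6 {Ω E : Type*} {mΩ : MeasurableSpace Ω} [MeasurableSpace E]
    (μ : Measure Ω) [IsProbabilityMeasure μ] (Z : Ω → E) (hZ : Measurable Z)
    (X : ℕ → Ω → ℝ) (hX : ∀ j, Measurable (X j)) (hX3 : ∀ j, MemLp (X j) 3 μ)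
    (hind : CondIndepGiven μ Z X)
    (n : ℕ) (hs : ∀ᵐ ω ∂μ, 0 < condStdDevSum μ Z X n ω) :
    Integrable (condNormalizedSum μ Z X n) μ ∧
    wassersteinOne (μ.map (condNormalizedSum μ Z X n)) (gaussianReal 0 1) ≤
      ENNReal.ofReal (2 * (√2 + 1)) *
        ∫⁻ ω, ENNReal.ofReal (1 / condStdDevSum μ Z X n ω ^ 3 *
          ∑ i ∈ Finset.Icc 1 n, |condCentered μ Z X i ω| ^ 3) ∂μ := by
  have hX2 : ∀ j, MemLp (X j) 2 μ := fun j => (hX3 j).mono_exponent (by norm_num)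
  have hY : ∀ i ∈ Finset.Icc 1 n, MemLp (condSummand μ Z X n i) 2 μ := fun i hi =>
    memLp_condSummand hZ hX2 hi hs
  simp only [condNormalizedSum_eq_sum, sum_abs_condSummand_pow_three]
  have hTi : Integrable (fun ω => ∑ i ∈ Finset.Icc 1 n, condSummand μ Z X n i ω) μ :=
    integrable_finsetSum _ fun i hi => (hY i hi).integrable one_le_two
  refine ⟨hTi, ?_⟩
  set R := ∫⁻ ω, ENNReal.ofReal (∑ i ∈ Finset.Icc 1 n, |condSummand μ Z X n i ω| ^ 3) ∂μ
  by_cases hRtop : R = ∞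
  · rw [hRtop, ENNReal.mul_top (by simp; positivity)]
    exact le_top
  have hnn : ∀ ω, 0 ≤ ∑ i ∈ Finset.Icc 1 n, |condSummand μ Z X n i ω| ^ 3 := fun ω =>
    Finset.sum_nonneg fun i _ => by positivity
  have hsm : ∀ i ∈ Finset.Icc 1 n,
      AEStronglyMeasurable (fun ω => |condSummand μ Z X n i ω| ^ 3) μ := fun i hi =>
    (hY i hi).aestronglyMeasurable.norm.pow 3
  have hsum : Integrable (fun ω => ∑ i ∈ Finset.Icc 1 n, |condSummand μ Z X n i ω| ^ 3) μ := by
    refine ⟨Finset.aestronglyMeasurable_fun_sum _ hsm, ?_⟩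
    rw [hasFiniteIntegral_iff_ofReal (Filter.Eventually.of_forall hnn)]
    exact lt_top_iff_ne_top.2 hRtop
  have hY3 : ∀ i ∈ Finset.Icc 1 n, Integrable (fun ω => |condSummand μ Z X n i ω| ^ 3) μ := by
    refine fun i hi => hsum.mono' (hsm i hi) (Filter.Eventually.of_forall fun ω => ?_)
    rw [Real.norm_of_nonneg (by positivity)]
    exact Finset.single_le_sum (f := fun i => |condSummand μ Z X n i ω| ^ 3)
      (fun j _ => by positivity) hi
  have hReq : R = ENNReal.ofReal (∑ i ∈ Finset.Icc 1 n, ∫ ω, |condSummand μ Z X n i ω| ^ 3 ∂μ) := by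
    rw [← integral_finsetSum _ hY3,
      ofReal_integral_eq_lintegral_ofReal hsum (Filter.Eventually.of_forall hnn)]
  refine iSup₂_le fun h hh => ?_
  rw [integral_map hTi.aemeasurable hh.continuous.aestronglyMeasurable, hReq,
    ← ENNReal.ofReal_mul (by positivity)]
  refine ENNReal.ofReal_le_ofReal ?_
  have hbound := abs_integral_lipschitz_sub_gaussian_le (μ := μ) (Finset.Icc 1 n)
    (G := sigmaOthers Z X) (sigmaOthers_le hZ hX) (Y := condSummand μ Z X n)
    (v := condSummandVar μ Z X n) hY hY3
    (fun i hi => by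
      classical
      simp only [← Finset.sum_erase_eq_sub hi]
      exact Finset.stronglyMeasurable_fun_sum _ fun j hj =>
        (stronglyMeasurable_condSummand n j).mono
          (sup_comap_le_sigmaOthers (X := X) (Finset.ne_of_mem_erase hj)))
    (fun i _ => (stronglyMeasurable_condSummandVar n i).mono le_sup_left)
    ((condSummandVar_nonneg n).mono fun ω hω i _ => hω i) (sum_condSummandVar hs)
    (fun i hi => (hind.condExp_sigmaOthers hZ hX i ((hY i hi).integrable one_le_two)
      (stronglyMeasurable_condSummand n i)).trans (condExp_condSummand hZ hX2 (hY i hi)))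
    (fun i hi => (hind.condExp_sigmaOthers hZ hX i (hY i hi).integrable_sq
      ((stronglyMeasurable_condSummand n i).pow 2)).trans (condExp_condSummand_sq hX2 (hY i hi)))
    hh
  refine hbound.trans (mul_le_mul_of_nonneg_right ?_ ?_)
  · have : (1 : ℝ) ≤ √2 := Real.one_le_sqrt.2 one_le_two
    linarith
  · exact Finset.sum_nonneg fun i _ => integral_nonneg fun ω => by positivity
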